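/- **Theorem (Enumeration of partial ternary paths and area).** A *ternary path* of length $n$ is a lattice path $(0,c_0),(1,c_1),\dots,(n,c_n)$ with $c_0=0$, all $c_t\ge 0$, and steps $(1,1)$ and $(1,-2)$. Reading such paths from right to left, a *reversed ternary path* of length $n$ is a lattice path $(0,c_0),(1,c_1),\dots,(n,c_n)$ with $c_0=0$, all $c_t\ge0$, and steps $(1,2)$ and $(1,-1)$. The *area* of a path is the sum of its ordinates $c_0+c_1+\cdots+c_n$. Binomial coefficients $\binom{a}{b}$ with $b<0$ are $0$. 1. (Left to right.) For all integers $N,K,i\ge 0$, the number of ternary paths of length $3N+i$ ending on level $3K+i$ is $$\binom{3N+i+1}{N-K}-3\binom{3N+i}{N-K-1}.$$ 2. (Right to left.) For all integers $i\ge 0$ and all (possibly negative) integers $N$ with $3N+2i\ge 0$, the number of reversed ternary paths of length $3N+2i$ ending on level $i$ is $$\sum_{0\le k\le i/2}\binom{i-k}{k}\left[\binom{3N+2i+1}{N+k}-3\binom{3N+2i}{N+k-1}\right].$$ 3. (Area.) For every integer $N\ge 0$, the sum of the areas of all ternary paths of length $3N$ that end on the $x$-axis is $$\sum_{k=0}^{N-1}3^{k+1}\binom{3N-k}{N-1-k}.$$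 -/

import Mathlib

/-- The steps `(1, d)` of a ternary path, read from left to right: `d = 1` or `d = -2`. -/
def ternarySteps : Finset ℤ := {1, -2}

/-- The steps of a ternary path read from right to left: each step `(1, d)` becomes `(1, -d)`,
so an up-step of two units or a down-step of one unit. -/
def reversedTernarySteps : Finset ℤ := {2, -1}

/-- The ordinate, at abscissa `t`, of the path that starts at the origin and whose successive steps
are `(1, s 0), (1, s 1), …, (1, s (n - 1))`. -/
def ordinate {n : ℕ} (s : Fin n → ℤ) (t : ℕ) : ℤ :=
  ∑ j ∈ Finset.univ.filter (fun j : Fin n => j.val < t), s j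

/-- The paths of length `n` with steps `(1, d)`, `d ∈ S`, that start at the origin, never go below
the `x`-axis and end on the given level. A path is given by its sequence of steps. -/
def pathsEndingAt (S : Finset ℤ) (n : ℕ) (level : ℤ) : Finset (Fin n → ℤ) :=
  (Fintype.piFinset fun _ : Fin n => S).filter
    fun s : Fin n → ℤ => (∀ t ≤ n, 0 ≤ ordinate s t) ∧ ordinate s n = level

/-- The area of a path: the sum `c 0 + c 1 + ⋯ + c n` of its ordinates. -/
def area {n : ℕ} (s : Fin n → ℤ) : ℤ :=
  ∑ t ∈ Finset.range (n + 1), ordinate s t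

/-- The binomial coefficient `a (a - 1) ⋯ (a - b + 1) / b!`, with the usual convention that it
vanishes when the lower index `b` is negative. -/
def binom (a b : ℤ) : ℤ :=
  if 0 ≤ b then Ring.choose a b.toNat else 0

/-! Deleting the last step gives recurrences for counts and areas; closed forms are checked against
them. A path of length `n` with `m` down-steps ends on level `n - 3m`, so without the axis the
recurrence is Pascal's. `ternaryCount` satisfies it everywhere and vanishes on level -1, the only
level below the axis from which an up-step returns; hence it counts correctly from level -1 upwards.
Right to left, the coefficients `(i - k).choose k` obey a Fibonacci recurrence
(`diagonalSum_add_two`) that, combined with Pascal's rule, matches the steps 2 and -1. For areas,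
each last point adds level times count. `areaSeries` solves the resulting recurrence in generating
functions, and its coefficient on level -1 vanishes. That, and the final simplification at `n = 3N`,
hold modulo series `m F - X F'`, whose `m`-th coefficient is 0. -/

/-! ### Decomposition of paths by their last step. -/

theorem ordinate_snoc_of_le {n : ℕ} (s : Fin n → ℤ) (d : ℤ) {t : ℕ} (ht : t ≤ n) :
    ordinate (Fin.snoc s d : Fin (n + 1) → ℤ) t = ordinate s t := by
  unfold ordinate
  rw [Finset.sum_filter, Finset.sum_filter, Fin.sum_univ_castSucc]
  simp [ht]

theorem ordinate_snoc_last {n : ℕ} (s : Fin n → ℤ) (d : ℤ) :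
    ordinate (Fin.snoc s d : Fin (n + 1) → ℤ) (n + 1) = ordinate s n + d := by
  unfold ordinate
  rw [Finset.sum_filter, Finset.sum_filter, Fin.sum_univ_castSucc]
  simp

theorem area_snoc {n : ℕ} (s : Fin n → ℤ) (d : ℤ) :
    area (Fin.snoc s d : Fin (n + 1) → ℤ) = area s + (ordinate s n + d) := by
  unfold area
  rw [Finset.sum_range_succ, ordinate_snoc_last]
  congr 1
  refine Finset.sum_congr rfl fun t ht => ordinate_snoc_of_le s d ?_
  have := Finset.mem_range.1 ht
  omega

theorem mem_pathsEndingAt {S : Finset ℤ} {n : ℕ} {h : ℤ} {s : Fin n → ℤ} :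
    s ∈ pathsEndingAt S n h ↔
      (∀ j, s j ∈ S) ∧ (∀ t ≤ n, 0 ≤ ordinate s t) ∧ ordinate s n = h := by
  simp [pathsEndingAt, Fintype.mem_piFinset]

theorem pathsEndingAt_of_neg (S : Finset ℤ) (n : ℕ) {h : ℤ} (hh : h < 0) :
    pathsEndingAt S n h = ∅ := by
  refine Finset.eq_empty_of_forall_notMem fun s hs => ?_
  obtain ⟨-, h1, h2⟩ := mem_pathsEndingAt.1 hs
  have := h1 n le_rfl
  omega

theorem snoc_mem_pathsEndingAt {S : Finset ℤ} {n : ℕ} {h d : ℤ} {s : Fin n → ℤ} (hh : 0 ≤ h) :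
    (Fin.snoc s d : Fin (n + 1) → ℤ) ∈ pathsEndingAt S (n + 1) h ↔
      d ∈ S ∧ s ∈ pathsEndingAt S n (h - d) := by
  rw [mem_pathsEndingAt, mem_pathsEndingAt, ordinate_snoc_last, Fin.forall_fin_succ']
  simp only [Fin.snoc_castSucc, Fin.snoc_last]
  constructor
  · rintro ⟨⟨h1, h2⟩, h3, h4⟩
    refine ⟨h2, h1, fun t ht => ?_, by omega⟩
    rw [← ordinate_snoc_of_le s d ht]
    exact h3 t (by omega)
  · rintro ⟨h2, h1, h3, h4⟩
    refine ⟨⟨h1, h2⟩, fun t ht => ?_, by omega⟩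
    rcases Nat.lt_or_ge n t with h5 | h5
    · obtain rfl : t = n + 1 := by omega
      rw [ordinate_snoc_last]
      omega
    · rw [ordinate_snoc_of_le s d h5]
      exact h3 t h5

theorem sum_pathsEndingAt_succ (S : Finset ℤ) (n : ℕ) {h : ℤ} (hh : 0 ≤ h)
    (w : (Fin (n + 1) → ℤ) → ℤ) :
    ∑ s ∈ pathsEndingAt S (n + 1) h, w s =
      ∑ d ∈ S, ∑ s ∈ pathsEndingAt S n (h - d), w (Fin.snoc s d) := by
  rw [Finset.sum_sigma']
  symm
  refine Finset.sum_bij' (fun x _ => (Fin.snoc x.2 x.1 : Fin (n + 1) → ℤ))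
    (fun s _ => ⟨s (Fin.last n), Fin.init s⟩) ?_ ?_ ?_ ?_ ?_
  · intro x hx
    exact (snoc_mem_pathsEndingAt hh).2 (Finset.mem_sigma.1 hx)
  · intro s hs
    refine Finset.mem_sigma.2 ((snoc_mem_pathsEndingAt hh).1 ?_)
    simpa using hs
  · rintro ⟨d, s⟩ _
    simp
  · intro s _
    simp
  · intro x _
    rfl

theorem card_pathsEndingAt_succ (S : Finset ℤ) (n : ℕ) {h : ℤ} (hh : 0 ≤ h) :
    ((pathsEndingAt S (n + 1) h).card : ℤ) = ∑ d ∈ S, ((pathsEndingAt S n (h - d)).card : ℤ) := by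
  simpa using sum_pathsEndingAt_succ S n hh fun _ => 1

theorem sum_area_pathsEndingAt_succ (S : Finset ℤ) (n : ℕ) {h : ℤ} (hh : 0 ≤ h) :
    ∑ s ∈ pathsEndingAt S (n + 1) h, area s =
      ∑ d ∈ S, ∑ s ∈ pathsEndingAt S n (h - d), area s +
        h * ((pathsEndingAt S (n + 1) h).card : ℤ) := by
  rw [sum_pathsEndingAt_succ S n hh, card_pathsEndingAt_succ S n hh, Finset.mul_sum,
    ← Finset.sum_add_distrib]
  refine Finset.sum_congr rfl fun d _ => ?_
  rw [mul_comm, ← nsmul_eq_mul, ← Finset.sum_const, ← Finset.sum_add_distrib]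
  refine Finset.sum_congr rfl fun s hs => ?_
  rw [area_snoc, (mem_pathsEndingAt.1 hs).2.2]
  ring

theorem pathsEndingAt_zero (S : Finset ℤ) (h : ℤ) :
    pathsEndingAt S 0 h = if h = 0 then Finset.univ else ∅ := by
  ext s
  rw [mem_pathsEndingAt]
  split_ifs with hh
  · simpa [ordinate, hh] using Subsingleton.elim s _
  · simp [ordinate, Ne.symm hh]

/-! ### Left-to-right enumeration. -/

theorem binom_natCast (a b : ℕ) : binom a b = a.choose b := by
  simp [binom, Ring.choose_natCast]

theorem binom_of_neg (a : ℤ) {b : ℤ} (hb : b < 0) : binom a b = 0 := by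
  simp [binom, hb]

theorem binom_succ (a : ℕ) (b : ℤ) :
    binom (a + 1) b = binom a b + binom a (b - 1) := by
  rcases lt_trichotomy b 0 with hb | rfl | hb
  · rw [binom_of_neg _ hb, binom_of_neg _ hb, binom_of_neg _ (by omega), add_zero]
  · simp [binom]
  · obtain ⟨c, rfl⟩ : ∃ c : ℕ, b = c + 1 := ⟨(b - 1).toNat, by omega⟩
    have h1 := binom_natCast (a + 1) (c + 1)
    have h2 := binom_natCast a (c + 1)
    push_cast at h1 h2
    rw [h1, h2, add_sub_cancel_right, binom_natCast, Nat.choose_succ_succ]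
    push_cast
    ring

/-- The number of ternary paths of length `n` with `m` down-steps. -/
def ternaryCount (n : ℕ) (m : ℤ) : ℤ := binom (n + 1) m - 3 * binom n (m - 1)

theorem ternaryCount_succ (n : ℕ) (m : ℤ) :
    ternaryCount (n + 1) m = ternaryCount n m + ternaryCount n (m - 1) := by
  have h1 := binom_succ (n + 1) m
  have h2 := binom_succ n (m - 1)
  unfold ternaryCount
  push_cast at h1 ⊢
  rw [h1, h2]
  ring

theorem ternaryCount_of_neg (n : ℕ) {m : ℤ} (hm : m < 0) : ternaryCount n m = 0 := by
  rw [ternaryCount, binom_of_neg _ hm, binom_of_neg _ (by omega), mul_zero, sub_zero]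

theorem ternaryCount_zero (m : ℤ) :
    ternaryCount 0 m = if m = 0 then 1 else if m = 1 then -2 else 0 := by
  rcases lt_or_ge m 0 with hm | hm
  · rw [ternaryCount_of_neg _ hm, if_neg (by omega), if_neg (by omega)]
  · lift m to ℕ using hm
    have h1 := binom_natCast 1 m
    push_cast at h1
    rw [ternaryCount, Nat.cast_zero, zero_add, h1]
    match m with
    | 0 => simp [binom]
    | 1 => simp [binom]
    | m + 2 =>
      have h2 := binom_natCast 0 (m + 1)
      have h3 : ((m + 2 : ℕ) : ℤ) - 1 = ((m + 1 : ℕ) : ℤ) := by push_cast; ring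
      rw [h3, ← Nat.cast_zero (R := ℤ), h2, Nat.choose_eq_zero_of_lt (by omega),
        Nat.choose_eq_zero_of_lt (by omega), if_neg (by simp; omega), if_neg (by simp; omega)]
      simp

/-- This is level -1, where the closed form must agree with the absence of paths; it rests on
`(3c+3).choose (c+1) = 3 * (3c+2).choose c`. -/
theorem ternaryCount_boundary {n : ℕ} {m : ℤ} (h : (n : ℤ) + 1 = 3 * m) : ternaryCount n m = 0 := by
  obtain ⟨c, rfl⟩ : ∃ c : ℕ, m = c + 1 := ⟨(m - 1).toNat, by omega⟩
  obtain rfl : n = 3 * c + 2 := by omega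
  have h1 := binom_natCast (3 * c + 2 + 1) (c + 1)
  have h2 := Nat.add_one_mul_choose_eq (3 * c + 2) c
  have h3 : (3 * c + 2 + 1).choose (c + 1) = 3 * (3 * c + 2).choose c := by
    apply Nat.eq_of_mul_eq_mul_right (Nat.succ_pos c)
    rw [Nat.succ_eq_add_one, ← h2]
    ring
  rw [ternaryCount, add_sub_cancel_right, binom_natCast]
  rw [h3] at h1
  push_cast at h1 ⊢
  rw [h1]
  ring

theorem card_pathsEndingAt_ternarySteps (n : ℕ) (m : ℤ) (h : -1 ≤ n - 3 * m) :
    ((pathsEndingAt ternarySteps n (n - 3 * m)).card : ℤ) = ternaryCount n m := by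
  induction n generalizing m with
  | zero =>
    rw [pathsEndingAt_zero, ternaryCount_zero]
    push_cast at h ⊢
    have h1 : m ≠ 1 := by omega
    by_cases hm : m = 0 <;> simp [hm, h1]
  | succ n ih =>
    rcases eq_or_lt_of_le h with h0 | h0
    · rw [pathsEndingAt_of_neg _ _ (by omega), ternaryCount_boundary (by omega)]
      simp
    · rw [card_pathsEndingAt_succ _ _ (by omega), ternarySteps, Finset.sum_pair (by norm_num),
        ternaryCount_succ, ← ih m (by push_cast at h0; omega),
        ← ih (m - 1) (by push_cast at h0; omega), ternarySteps]
      push_cast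
      ring_nf

/-! ### Right-to-left enumeration. -/

/-- The sum `∑ k, (i - k).choose k * g (M + k)`, taken over `k ≤ i / 2`. -/
def diagonalSum (g : ℤ → ℤ) (i : ℕ) (M : ℤ) : ℤ :=
  ∑ k ∈ Finset.range (i / 2 + 1), ((i - k).choose k : ℤ) * g (M + k)

theorem diagonalSum_eq_sum_range (g : ℤ → ℤ) {i L : ℕ} (hL : i < 2 * L) (M : ℤ) :
    diagonalSum g i M = ∑ k ∈ Finset.range L, ((i - k).choose k : ℤ) * g (M + k) := by
  refine Finset.sum_subset (fun k hk => ?_) fun k _ hk => ?_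
  · simp only [Finset.mem_range] at hk ⊢
    omega
  · simp only [Finset.mem_range] at hk
    rw [Nat.choose_eq_zero_of_lt (by omega)]
    simp

theorem diagonalSum_zero (g : ℤ → ℤ) (M : ℤ) : diagonalSum g 0 M = g M := by
  simp [diagonalSum]

theorem diagonalSum_one (g : ℤ → ℤ) (M : ℤ) : diagonalSum g 1 M = g M := by
  simp [diagonalSum]

theorem diagonalSum_add_two (g : ℤ → ℤ) (i : ℕ) (M : ℤ) :
    diagonalSum g (i + 2) M = diagonalSum g (i + 1) M + diagonalSum g i (M + 1) := by
  rw [diagonalSum_eq_sum_range g (L := i + 2) (by omega),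
    diagonalSum_eq_sum_range g (i := i + 1) (L := i + 2) (by omega),
    diagonalSum_eq_sum_range g (i := i) (L := i + 1) (by omega),
    Finset.sum_range_succ', Finset.sum_range_succ' _ (i + 1), add_right_comm,
    ← Finset.sum_add_distrib]
  congr 1
  refine Finset.sum_congr rfl fun k hk => ?_
  have hk := Finset.mem_range.1 hk
  have e1 : i + 2 - (k + 1) = (i - k) + 1 := by omega
  have e2 : i + 1 - (k + 1) = i - k := by omega
  have e3 : M + ((k + 1 : ℕ) : ℤ) = M + 1 + k := by push_cast; ring
  rw [e1, e2, e3, Nat.choose_succ_succ]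
  push_cast
  ring

theorem diagonalSum_add_shift (g : ℤ → ℤ) (i : ℕ) (M : ℤ) :
    diagonalSum (fun m => g m + g (m - 1)) i M = diagonalSum g i M + diagonalSum g i (M - 1) := by
  simp only [diagonalSum, ← Finset.sum_add_distrib, mul_add]
  refine Finset.sum_congr rfl fun k _ => ?_
  rw [add_sub_right_comm]

theorem diagonalSum_ternaryCount_zero (i : ℕ) (N : ℤ) (h : 3 * N + 2 * i = 0) :
    diagonalSum (ternaryCount 0) i N = if i = 0 then 1 else 0 := by
  rcases Nat.eq_zero_or_pos i with rfl | hi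
  · obtain rfl : N = 0 := by simpa using h
    simp [diagonalSum_zero, ternaryCount_zero]
  · rw [if_neg hi.ne']
    refine Finset.sum_eq_zero fun k hk => ?_
    have := Finset.mem_range.1 hk
    -- Here `N + k ≤ -2i/3 + i/2 < 0`.
    rw [ternaryCount_zero, if_neg (by omega), if_neg (by omega), mul_zero]

theorem card_pathsEndingAt_reversedTernarySteps (n i : ℕ) (N : ℤ) (h : (n : ℤ) = 3 * N + 2 * i) :
    ((pathsEndingAt reversedTernarySteps n i).card : ℤ) = diagonalSum (ternaryCount n) i N := by
  induction n generalizing i N with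
  | zero =>
    rw [pathsEndingAt_zero, diagonalSum_ternaryCount_zero _ _ (by simpa using h.symm)]
    by_cases hi : i = 0 <;> simp [hi]
  | succ n ih =>
    have hrec : ternaryCount (n + 1) = fun m => ternaryCount n m + ternaryCount n (m - 1) :=
      funext fun m => ternaryCount_succ n m
    have hup := ih (i + 1) (N - 1) (by push_cast at h ⊢; omega)
    rw [card_pathsEndingAt_succ _ _ (by positivity), reversedTernarySteps,
      Finset.sum_pair (by norm_num), ← reversedTernarySteps, hrec, diagonalSum_add_shift,
      sub_neg_eq_add]
    push_cast at hup h
    rw [hup]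
    match i with
    -- Level -2 has no paths, and the surplus term `ternaryCount n N` sits on the boundary `n + 1 =
    -- 3N`.
    | 0 =>
      rw [pathsEndingAt_of_neg _ _ (by norm_num), zero_add, diagonalSum_one, diagonalSum_zero,
        diagonalSum_zero, ternaryCount_boundary (m := N) (by simpa using h)]
      simp
    | 1 =>
      rw [pathsEndingAt_of_neg _ _ (by norm_num), diagonalSum_add_two, zero_add, diagonalSum_one,
        diagonalSum_one, diagonalSum_zero, sub_add_cancel]
      simp [add_comm]
    | i + 2 =>
      have hdown := ih i (N + 1) (by push_cast at h ⊢; omega)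
      have e : ((i + 2 : ℕ) : ℤ) - 2 = i := by push_cast; ring
      rw [e, hdown, diagonalSum_add_two _ (i + 1), diagonalSum_add_two _ i N, sub_add_cancel]
      ring

/-! ### Area, by generating functions in the number of down-steps. -/

namespace TernaryPath

open PowerSeries

/-- The power series `1 / (1 - 2X)`. -/
noncomputable def U : ℤ⟦X⟧ := invOfUnit (1 - 2 * X) 1

/-- The power series `1 / (1 + X)`. -/
noncomputable def V : ℤ⟦X⟧ := invOfUnit (1 + X) 1

theorem mul_U : (1 - 2 * X : ℤ⟦X⟧) * U = 1 := mul_invOfUnit _ _ (by simp)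

theorem mul_V : (1 + X : ℤ⟦X⟧) * V = 1 := mul_invOfUnit _ _ (by simp)

theorem derivative_ofNat (k : ℕ) [k.AtLeastTwo] :
    derivative ℤ (ofNat(k) : ℤ⟦X⟧) = 0 :=
  Derivation.map_natCast _ k

theorem derivative_one_sub_two_mul_X : derivative ℤ (1 - 2 * X : ℤ⟦X⟧) = -2 := by
  rw [map_sub, Derivation.leibniz, derivative_one, derivative_ofNat, derivative_X, smul_eq_mul,
    smul_eq_mul]
  ring

theorem derivative_U : derivative ℤ U = 2 * U ^ 2 := by
  have h := congrArg (derivative ℤ) mul_U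
  rw [Derivation.leibniz, derivative_one_sub_two_mul_X, derivative_one, smul_eq_mul,
    smul_eq_mul] at h
  linear_combination U * h - derivative ℤ U * mul_U

theorem derivative_one_add_X : derivative ℤ (1 + X : ℤ⟦X⟧) = 1 := by
  rw [map_add, derivative_one, derivative_X, zero_add]

theorem derivative_V : derivative ℤ V = -V ^ 2 := by
  have h := congrArg (derivative ℤ) mul_V
  rw [Derivation.leibniz, derivative_one_add_X, derivative_one, smul_eq_mul, smul_eq_mul] at h
  linear_combination V * h - derivative ℤ V * mul_V

theorem derivative_one_add_X_pow (n : ℕ) :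
    derivative ℤ ((1 + X : ℤ⟦X⟧) ^ n) = (n : ℤ⟦X⟧) * (1 + X) ^ n * V := by
  rw [derivative_pow, derivative_one_add_X]
  rcases n with _ | n
  · simp
  · rw [Nat.add_sub_cancel, pow_succ]
    linear_combination -((n + 1 : ℕ) : ℤ⟦X⟧) * (1 + X) ^ n * mul_V

theorem coeff_natCast_mul (m k : ℕ) (f : ℤ⟦X⟧) : coeff m ((k : ℤ⟦X⟧) * f) = k * coeff m f := by
  rw [← nsmul_eq_mul, map_nsmul, nsmul_eq_mul]

theorem coeff_X_mul_derivative (m : ℕ) (f : ℤ⟦X⟧) :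
    coeff m (X * derivative ℤ f) = m * coeff m f := by
  rcases m with _ | m
  · simp
  · rw [coeff_succ_X_mul, coeff_derivative]
    push_cast
    ring

/-- Formally, the derivative of `X^(-m) f` has no residue. -/
theorem coeff_natCast_mul_sub_X_mul_derivative (m : ℕ) (f : ℤ⟦X⟧) :
    coeff m ((m : ℤ⟦X⟧) * f - X * derivative ℤ f) = 0 := by
  rw [map_sub, coeff_natCast_mul, coeff_X_mul_derivative, sub_self]

theorem coeff_succ_one_add_X_mul (m : ℕ) (f : ℤ⟦X⟧) :
    coeff (m + 1) ((1 + X) * f) = coeff (m + 1) f + coeff m f := by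
  rw [add_mul, one_mul, map_add, coeff_succ_X_mul]

theorem coeff_zero_one_add_X_mul (f : ℤ⟦X⟧) : coeff 0 ((1 + X) * f) = coeff 0 f := by
  simp

/-- The generating function, by number of down-steps, of the ternary paths of length `n`. -/
noncomputable def countSeries (n : ℕ) : ℤ⟦X⟧ := (1 + X) ^ n * (1 - 2 * X)

theorem coeff_countSeries (n m : ℕ) : coeff m (countSeries n) = ternaryCount n m := by
  induction n generalizing m with
  | zero =>
    have e : countSeries 0 = 1 - (X + X) := by rw [countSeries]; ring
    rw [ternaryCount_zero, e]
    simp only [map_sub, map_add, coeff_one, coeff_X]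
    match m with
    | 0 => simp
    | 1 => simp
    | m + 2 => simp; omega
  | succ n ih =>
    have e : countSeries (n + 1) = (1 + X) * countSeries n := by simp only [countSeries]; ring
    rw [e, ternaryCount_succ]
    rcases m with _ | m
    · rw [coeff_zero_one_add_X_mul, ih, 
        ternaryCount_of_neg n (m := ((0 : ℕ) : ℤ) - 1) (by norm_num), add_zero]
    · rw [coeff_succ_one_add_X_mul, ih, ih]
      push_cast
      rw [add_sub_cancel_right]

/-- The generating function, by number of down-steps, of twice the total area of the ternary paths
of length `n`. -/
noncomputable def areaSeries (n : ℕ) : ℤ⟦X⟧ :=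
  (1 + X) ^ n * (((n : ℤ⟦X⟧) + 1) * (n : ℤ⟦X⟧) * (1 - 2 * X) ^ 2 * V + 12 * (n : ℤ⟦X⟧) * X
    - 6 * X * (1 + 11 * X - 8 * X ^ 2) * U ^ 2)

theorem derivative_countSeries (n : ℕ) :
    derivative ℤ (countSeries n) = (1 + X) ^ n * ((n : ℤ⟦X⟧) * (1 - 2 * X) * V - 2) := by
  rw [countSeries, Derivation.leibniz, derivative_one_sub_two_mul_X, derivative_one_add_X_pow,
    smul_eq_mul, smul_eq_mul]
  ring

/-- The added term encodes twice level times count, `2(n+1) - 6m` times the count, with `m` realised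
as `X d/dX`. The summand of `areaSeries` in `U ^ 2` is a homogeneous solution, fitted to the
boundary condition. -/
theorem areaSeries_succ (n : ℕ) :
    areaSeries (n + 1) = (1 + X) * areaSeries n +
      (((2 * (n + 1) : ℕ) : ℤ⟦X⟧) * countSeries (n + 1) -
        ((6 : ℕ) : ℤ⟦X⟧) * (X * derivative ℤ (countSeries (n + 1)))) := by
  rw [derivative_countSeries, areaSeries, areaSeries, countSeries]
  push_cast
  linear_combination (2 * (1 + X) ^ (n + 1) * (n + 1) * (1 - 2 * X)) * mul_V

theorem coeff_areaSeries_boundary {n m : ℕ} (h : n + 1 = 3 * m) : coeff m (areaSeries n) = 0 := by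
  rw [← coeff_natCast_mul_sub_X_mul_derivative m ((1 + X) ^ (3 * m) *
    (9 * (m : ℤ⟦X⟧) * (1 - 2 * X) * V - 3 * (1 - 2 * X) * V + 36 * X * U - 27 * X * U * V))]
  congr 1
  have hE : (1 + X : ℤ⟦X⟧) ^ n = (1 + X) ^ (3 * m) * V := by
    rw [← h, pow_succ, mul_assoc, mul_V, mul_one]
  have hn : (n : ℤ⟦X⟧) = 3 * (m : ℤ⟦X⟧) - 1 := by
    have h' := congrArg (Nat.cast : ℕ → ℤ⟦X⟧) h
    push_cast at h'
    linear_combination h'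
  rw [areaSeries, hE, hn]
  simp only [Derivation.leibniz, map_add, map_sub _ (_ : ℤ⟦X⟧) (_ : ℤ⟦X⟧), derivative_ofNat,
    Derivation.map_natCast, derivative_one, derivative_one_add_X_pow, smul_eq_mul, derivative_U,
    derivative_V, derivative_X]
  -- With `(1 + X)^(3m)` divided out, a rational function identity remains; the factor `1 - 3 * x *
  -- v` comes from differentiating that power.
  have key : ∀ x m u v : ℤ⟦X⟧, (1 - 2 * x) * u = 1 → (1 + x) * v = 1 →
      v * ((3 * m - 1 + 1) * (3 * m - 1) * (1 - 2 * x) ^ 2 * v + 12 * (3 * m - 1) * x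
        - 6 * x * (1 + 11 * x - 8 * x ^ 2) * u ^ 2) =
      m * (9 * m * (1 - 2 * x) * v - 3 * (1 - 2 * x) * v + 36 * x * u - 27 * x * u * v)
          * (1 - 3 * x * v)
        - x * (9 * m * (-2 * v - (1 - 2 * x) * v ^ 2) - 3 * (-2 * v - (1 - 2 * x) * v ^ 2)
          + 36 * u + 72 * x * u ^ 2 - 27 * (u * v + 2 * x * u ^ 2 * v - x * u * v ^ 2)) := by
    intro x m u v hu hv
    grind
  have key := key X m U V mul_U mul_V
  push_cast
  linear_combination (1 + X) ^ (3 * m) * key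

theorem coeff_areaSeries_three_mul (N : ℕ) :
    coeff N (areaSeries (3 * N)) = 2 * coeff N ((1 + X) ^ (3 * N) * (3 * X * (1 + X) * U)) := by
  have h2 := coeff_natCast_mul N 2 ((1 + X) ^ (3 * N) * (3 * X * (1 + X) * U))
  rw [Nat.cast_ofNat, Nat.cast_ofNat] at h2
  rw [← h2, ← sub_eq_zero, ← map_sub,
    ← coeff_natCast_mul_sub_X_mul_derivative N ((1 + X) ^ (3 * N) *
      (9 * (N : ℤ⟦X⟧) * (1 - 2 * X) + 3 * (1 - 2 * X) + 18 * X * (1 + X) * U))]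
  congr 1
  rw [areaSeries]
  simp only [Derivation.leibniz, map_add, map_sub _ (_ : ℤ⟦X⟧) (_ : ℤ⟦X⟧), derivative_ofNat,
    Derivation.map_natCast, derivative_one, derivative_one_add_X_pow, smul_eq_mul, derivative_U,
    derivative_X]
  have key : ∀ x m u v : ℤ⟦X⟧, (1 - 2 * x) * u = 1 → (1 + x) * v = 1 →
      (3 * m + 1) * (3 * m) * (1 - 2 * x) ^ 2 * v + 36 * m * x
        - 6 * x * (1 + 11 * x - 8 * x ^ 2) * u ^ 2 - 6 * x * (1 + x) * u =
      m * (9 * m * (1 - 2 * x) + 3 * (1 - 2 * x) + 18 * x * (1 + x) * u) * (1 - 3 * x * v)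
        - x * (-18 * m - 6 + 18 * (1 + 2 * x) * u + 36 * x * (1 + x) * u ^ 2) := by
    intro x m u v hu hv
    grind
  have key := key X N U V mul_U mul_V
  push_cast
  linear_combination (1 + X) ^ (3 * N) * key

theorem coeff_one_add_X_pow (n m : ℕ) : coeff m ((1 + X : ℤ⟦X⟧) ^ n) = n.choose m := by
  have h : (1 + X : ℤ⟦X⟧) ^ n = (((1 + Polynomial.X) ^ n : Polynomial ℤ) : ℤ⟦X⟧) := by simp
  rw [h, Polynomial.coeff_coe, Polynomial.coeff_one_add_X_pow]

/-- Since `1 - 2X = (1 + X) - 3X`, the series `(1 + X) U` is geometric with ratio `3X / (1 + X)`.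
The remainder, divisible by `X ^ (L + 1)`, does not affect the coefficient of `X ^ L`. -/
theorem one_add_X_pow_mul_geometric (n L : ℕ) (h : L ≤ n) :
    (1 + X) ^ n * (3 * X * (1 + X) * U) =
      ∑ k ∈ Finset.range L, ((3 ^ (k + 1) : ℕ) : ℤ⟦X⟧) * (X ^ (k + 1) * (1 + X) ^ (n - k)) +
        X ^ (L + 1) * (3 ^ (L + 1) * (1 + X) ^ (n - L) * (1 + X) * U) := by
  induction L with
  | zero => simp; ring
  | succ L ih =>
    have e : n - L = n - (L + 1) + 1 := by omega
    rw [ih (by omega), Finset.sum_range_succ, e]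
    push_cast
    linear_combination (X ^ (L + 1) * 3 ^ (L + 1) * (1 + X) ^ (n - (L + 1)) * (1 + X)) * mul_U

theorem coeff_one_add_X_pow_mul_geometric (N : ℕ) :
    coeff N ((1 + X) ^ (3 * N) * (3 * X * (1 + X) * U)) =
      ∑ k ∈ Finset.range N, 3 ^ (k + 1) * ((3 * N - k).choose (N - 1 - k) : ℤ) := by
  rw [one_add_X_pow_mul_geometric (3 * N) N (by omega), map_add, map_sum, coeff_X_pow_mul',
    if_neg (by omega), add_zero]
  refine Finset.sum_congr rfl fun k hk => ?_
  have hk := Finset.mem_range.1 hk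
  rw [coeff_natCast_mul, coeff_X_pow_mul', if_pos (by omega), coeff_one_add_X_pow,
    show N - (k + 1) = N - 1 - k by omega]
  push_cast
  rfl

theorem coeff_areaSeries (n m : ℕ) (h : -1 ≤ (n : ℤ) - 3 * m) :
    2 * ∑ s ∈ pathsEndingAt ternarySteps n (n - 3 * m), area s = coeff m (areaSeries n) := by
  induction n generalizing m with
  | zero =>
    obtain rfl : m = 0 := by push_cast at h; omega
    rw [areaSeries]
    simp [pathsEndingAt_zero, area, ordinate]
  | succ n ih =>
    rcases eq_or_lt_of_le h with h0 | h0
    · rw [pathsEndingAt_of_neg _ _ (by omega), coeff_areaSeries_boundary (by omega)]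
      simp
    · rw [sum_area_pathsEndingAt_succ _ _ (by omega), card_pathsEndingAt_ternarySteps _ _ h,
        areaSeries_succ, map_add, map_sub, coeff_natCast_mul, coeff_natCast_mul,
        coeff_X_mul_derivative, coeff_countSeries, ternarySteps, Finset.sum_pair (by norm_num),
        ← ternarySteps]
      have h1 := ih m (by push_cast at h0; omega)
      have e1 : ((n + 1 : ℕ) : ℤ) - 3 * m - 1 = n - 3 * m := by push_cast; ring
      rw [e1]
      rcases m with _ | m
      -- A final down-step would leave a path with -1 down-steps.
      · have h2 : pathsEndingAt ternarySteps n (((n + 1 : ℕ) : ℤ) - 3 * (0 : ℕ) - -2) = ∅ := by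
          have h3 := card_pathsEndingAt_ternarySteps n (-1) (by omega)
          rw [ternaryCount_of_neg _ (by norm_num)] at h3
          rw [← Finset.card_eq_zero, ← Nat.cast_eq_zero (R := ℤ), ← h3]
          congr 3
        rw [h2, coeff_zero_one_add_X_mul, ← h1, Finset.sum_empty]
        push_cast
        ring
      · have h2 := ih m (by push_cast at h0 ⊢; omega)
        have e2 : ((n + 1 : ℕ) : ℤ) - 3 * (m + 1 : ℕ) - -2 = n - 3 * m := by push_cast; ring
        rw [e2, coeff_succ_one_add_X_mul, ← h1, ← h2]
        push_cast
        ring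

end TernaryPath

theorem mainTheorem1 :
    (∀ N K i : ℕ,
      ((pathsEndingAt ternarySteps (3 * N + i) (3 * K + i)).card : ℤ) =
        binom (3 * N + i + 1) (N - K) - 3 * binom (3 * N + i) (N - K - 1)) ∧
    (∀ (n i : ℕ) (N : ℤ), (n : ℤ) = 3 * N + 2 * i →
      ((pathsEndingAt reversedTernarySteps n i).card : ℤ) =
        ∑ k ∈ Finset.range (i / 2 + 1), ((i - k).choose k : ℤ) *
          (binom (3 * N + 2 * i + 1) (N + k) - 3 * binom (3 * N + 2 * i) (N + k - 1))) ∧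
    (∀ N : ℕ,
      ∑ s ∈ pathsEndingAt ternarySteps (3 * N) 0, area s =
        ∑ k ∈ Finset.range N, 3 ^ (k + 1) * ((3 * N - k).choose (N - 1 - k) : ℤ)) := by
  refine ⟨fun N K i => ?_, fun n i N h => ?_, fun N => ?_⟩
  · have h := card_pathsEndingAt_ternarySteps (3 * N + i) (N - K) (by push_cast; omega)
    rw [ternaryCount] at h
    push_cast at h
    rw [← h]
    congr 3
    ring
  · rw [card_pathsEndingAt_reversedTernarySteps n i N h, diagonalSum, ← h]
    rfl
  · have h := TernaryPath.coeff_areaSeries (3 * N) N (by push_cast; omega)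
    rw [TernaryPath.coeff_areaSeries_three_mul, TernaryPath.coeff_one_add_X_pow_mul_geometric,
      Nat.cast_mul, Nat.cast_ofNat, sub_self] at h
    exact mul_left_cancel₀ two_ne_zero h
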